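/- Let $A$ be a finite set with at least two elements, let $B$ be a set with at least two elements, let $n>3$, and let $f\colon A^n\to B$ depend on all of its $n$ variables (that is, every variable is essential). Then $\operatorname{gap} f=2$ if and only if one of the following holds: 1. $\operatorname{qa} f=n-2$; 2. $\operatorname{qa} f=n$ and $f|_{A^n_=}$ is determined by $\operatorname{oddsupp}$. Here the notions are as follows. A variable $x_i$ is *essential* in a function $g\colon A^m\to B$ if changing the $i$-th entry of some tuple in $A^m$ changes the value of $g$; the *essential arity* $\operatorname{ess} g$ is the number of essential variables of $g$. A function $g\colon A^m\to B$ is a *simple minor* of $f\colon A^n\to B$, written $g\le f$, if $g(x_1,\dots,x_m)=f(x_{\sigma(1)},\dots,x_{\sigma(n)})$ for some map $\sigma\colon\{1,\dots,n\}\to\{1,\dots,m\}$; we write $g<f$ if $g\le f$ and not $f\le g$. The *arity gap* of $f$ is $\operatorname{gap} f=\operatorname{ess} f-\max_{g<f}\operatorname{ess} g$, where $g$ ranges over functions of all arities. Let $A^n_=$ be the set of tuples $(a_1,\dots,a_n)\in A^n$ with $a_i=a_j$ for some $i\ne j$. The *quasi-arity* $\operatorname{qa} f$ is the minimum of $\operatorname{ess}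 g$ over all $g\colon A^n\to B$ with $g|_{A^n_=}=f|_{A^n_=}$. For $\mathbf a\in A^n$ let $\operatorname{oddsupp}(\mathbf a)$ be the set of those elements of $A$ that occur an odd number of times among $a_1,\dots,a_n$, and let $\mathcal P'(A)$ be the set of all subsets $S\subseteq A$ with $|S|\equiv n\pmod 2$ and $|S|\le n-2$. We say that $f|_{A^n_=}$ is *determined by* $\operatorname{oddsupp}$ if there is a nonconstant function $f^*\colon\mathcal P'(A)\to B$ with $f(\mathbf a)=f^*(\operatorname{oddsupp}(\mathbf a))$ for all $\mathbf a\in A^n_=$. -/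

import Mathlib

namespace ArityGap

/-- The set of `n`-tuples over `A` with a repeated entry (for `n ≥ 2`). -/
def tuplesWithRepetition (A : Type*) (n : ℕ) : Set (Fin n → A) :=
  {a | ∃ i j : Fin n, i ≠ j ∧ a i = a j}

/-- The `i`-th variable is essential in `f` (`f` depends on it): changing the `i`-th entry of some
tuple changes the value of `f`. -/
def IsEssential {A B : Type*} {n : ℕ} (f : (Fin n → A) → B) (i : Fin n) : Prop :=
  ∃ (a : Fin n → A) (b : A), f a ≠ f (Function.update a i b)

/-- The essential arity of `f`: the number of its essential variables. -/
noncomputable def ess {A B : Type*} {n : ℕ} (f : (Fin n → A) → B) : ℕ :=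
  {i : Fin n | IsEssential f i}.ncard

/-- `g`, of arity `m`, is a simple minor of `f`, of arity `n`: it arises from `f` by substituting
the variable `x_{σ i}` of `g` for the variable `x_i` of `f`, for all `i`. -/
def IsMinor {A B : Type*} {m n : ℕ} (g : (Fin m → A) → B) (f : (Fin n → A) → B) : Prop :=
  ∃ σ : Fin n → Fin m, ∀ a : Fin m → A, g a = f (fun i => a (σ i))

/-- `g < f` in the simple minor quasi-order. -/
def IsStrictMinor {A B : Type*} {m n : ℕ} (g : (Fin m → A) → B) (f : (Fin n → A) → B) : Prop :=
  IsMinor g f ∧ ¬ IsMinor f g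

/-- The maximum of the essential arities of the strict simple minors (of any arity) of `f`.
It is a maximum of a bounded set, since a simple minor of `f` has at most `ess f` essential
variables; the set is nonempty as soon as `f` has at least two essential variables. -/
noncomputable def essLower {A B : Type*} {n : ℕ} (f : (Fin n → A) → B) : ℕ :=
  sSup {e | ∃ (m : ℕ) (g : (Fin m → A) → B), IsStrictMinor g f ∧ ess g = e}

/-- The arity gap of `f` (the subtraction does not truncate, as `essLower f ≤ ess f`). -/
noncomputable def gap {A B : Type*} {n : ℕ} (f : (Fin n → A) → B) : ℕ :=
  ess f - essLower f

/-- `g` is a support of `f`: it agrees with `f` on the tuples with a repeated entry. -/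
def IsSupport {A B : Type*} {n : ℕ} (g f : (Fin n → A) → B) : Prop :=
  Set.EqOn g f (tuplesWithRepetition A n)

/-- The quasi-arity of `f`: the minimum of the essential arities of its supports (there is one,
namely `f`). -/
noncomputable def qa {A B : Type*} {n : ℕ} (f : (Fin n → A) → B) : ℕ :=
  sInf {e | ∃ g : (Fin n → A) → B, IsSupport g f ∧ ess g = e}

/-- The set of those entries of `a` that occur in `a` an odd number of times. -/
def oddsupp {A : Type*} {n : ℕ} (a : Fin n → A) : Set A :=
  {x | ∃ i : Fin n, a i = x ∧ Odd {j : Fin n | a j = a i}.ncard}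

/-- The subsets of the finite set `A` whose order has the parity of `n` and is at most `n - 2`. -/
def paritySubsets (A : Type*) (n : ℕ) : Set (Set A) :=
  {S | (Odd S.ncard ↔ Odd n) ∧ S.ncard + 2 ≤ n}

/-- The restriction of `f` to the tuples with a repeated entry is determined by `oddsupp`: it is
`fstar ∘ oddsupp`, where `fstar` is nonconstant on `paritySubsets A n` (which contains `oddsupp a`
for every tuple `a` with a repeated entry, so that other values of `fstar` play no role). -/
def RestrictionDeterminedByOddsupp {A B : Type*} {n : ℕ} (f : (Fin n → A) → B) : Prop :=
  ∃ fstar : Set A → B,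
    (∃ S ∈ paritySubsets A n, ∃ T ∈ paritySubsets A n, fstar S ≠ fstar T) ∧
    ∀ a ∈ tuplesWithRepetition A n, f a = fstar (oddsupp a)

end ArityGap

namespace ArityGap

/-! Every strict minor of `f` identifies two variables, so `gap f = 2` means that all minors
obtained by one identification have essential arity at most n - 2, with equality for some
(`gap_eq_two_iff`). Hence on each diagonal x_i = x_j a third entry or the pair {i, j} is an
inessential block.

If `qa f < n`, a support of least essential arity misses a variable, so it is itself an
identification minor; both bounds then force its arity to be n - 2. Conversely, a support of arity n
- 2 has the same identification minors as `f` and is one of them.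

If `qa f = n`, take a diagonal attaining n - 2, which has exactly one inessential block. Were this a
single entry r, `exists_agreeOn_of_inessentialOn_single` would give a support independent of r, a
contradiction. So the block is the pair, and `OnlyPairInessential.all` carries this to every
diagonal. Overwriting equal pairs then permutes entries (`apply_comp_swap`) and changes doubled
values at will, so only `oddsupp` matters (`apply_eq_of_oddsupp_eq`). Conversely, if `oddsupp`
determines the restriction, each identification loses exactly its two variables
(`RestrictionDeterminedByOddsupp.ess_identify`). -/

/-- `f` restricted to the tuples with `x i = x j` does not depend on the entries indexed by `K`. -/
def InessentialOn {ι A B : Type*} (f : (ι → A) → B) (i j : ι) (K : Set ι) : Prop :=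
  ∀ x y : ι → A, x i = x j → y i = y j → (∀ l, l ∉ K → x l = y l) → f x = f y

/-- `f` and `g` agree on the tuples with `x i = x j`. -/
def AgreeOn {ι A B : Type*} (f g : (ι → A) → B) (i j : ι) : Prop :=
  ∀ x : ι → A, x i = x j → f x = g x

/-! ### Spreading agreement with one function from one diagonal to all. -/

section Agreement

variable {ι A B : Type*} {f G : (ι → A) → B} {p q r i j k : ι}

theorem AgreeOn.symm (h : AgreeOn f G i j) : AgreeOn f G j i := fun x hx => h x hx.symm

theorem InessentialOn.symm {K : Set ι} (h : InessentialOn f i j K) : InessentialOn f j i K :=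
  fun x y hx hy => h x y hx.symm hy.symm

/-- If `G` depends on its `k`-th entry and `f (t x) = G x` for tuples `t x` with equal `i`-th and
`j`-th entries, where `t x` and `t y` agree off `K` whenever `x` and `y` agree off `k`, then `f`
depends on `K` on the tuples with equal `i`-th and `j`-th entries. -/
theorem not_inessentialOn_of_lift {K : Set ι} (t : (ι → A) → ι → A)
    (hG : ∃ x y : ι → A, (∀ l, l ≠ k → x l = y l) ∧ G x ≠ G y)
    (ht : ∀ x, t x i = t x j) (hf : ∀ x, f (t x) = G x)
    (hK : ∀ x y : ι → A, (∀ l, l ≠ k → x l = y l) → ∀ l, l ∉ K → t x l = t y l) :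
    ¬ InessentialOn f i j K := by
  obtain ⟨x, y, hxy, hne⟩ := hG
  intro h
  apply hne
  rw [← hf, ← hf]
  exact h _ _ (ht x) (ht y) (hK x y hxy)

/-- Replace the entries `q` and `r` of `x` by `u` and `v`. -/
def replaceTwo [DecidableEq ι] (x : ι → A) (q r : ι) (u v : A) : ι → A :=
  fun l => if l = q then u else if l = r then v else x l

/-- `G` does not depend on the entries `q` and `r` but on all others, `G'` arises from `G` by
interchanging `p` and `q`, and `f` agrees with `G` on the tuples with equal entries `p` and `q`. -/
structure Twin (f G G' : (ι → A) → B) (p q r : ι) : Prop where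
  hpq : p ≠ q
  hpr : p ≠ r
  hqr : q ≠ r
  eq_of_eq : ∀ x y : ι → A, (∀ l, l ≠ q → l ≠ r → x l = y l) → G x = G y
  depends : ∀ k, k ≠ q → k ≠ r → ∃ x y : ι → A, (∀ l, l ≠ k → x l = y l) ∧ G x ≠ G y
  eq_of_eq' : ∀ x y : ι → A, (∀ l, l ≠ p → l ≠ r → x l = y l) → G' x = G' y
  depends' : ∀ k, k ≠ p → k ≠ r → ∃ x y : ι → A, (∀ l, l ≠ k → x l = y l) ∧ G' x ≠ G' y
  interchange : ∀ x z : ι → A, z q = x p → (∀ l, l ≠ p → l ≠ q → l ≠ r → z l = x l) → G' z = G x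
  agree : AgreeOn f G p q

namespace Twin

variable {G' : (ι → A) → B}

theorem agree' (h : Twin f G G' p q r) : AgreeOn f G' p q := by
  intro x hx
  rw [h.agree x hx]
  exact (h.interchange x x (by grind) (by grind)).symm

variable [DecidableEq ι]

theorem symm (h : Twin f G G' p q r) : Twin f G' G q p r where
  hpq := h.hpq.symm
  hpr := h.hqr
  hqr := h.hpr
  eq_of_eq := h.eq_of_eq'
  depends := h.depends'
  eq_of_eq' := h.eq_of_eq
  depends' := h.depends
  interchange := fun x z h1 h2 => by
    have hq := h.hpq
    rw [← h.interchange z (Function.update x q (z p)) (by grind) (by grind)]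
    exact h.eq_of_eq' _ _ (by grind)
  agree := h.agree'.symm

/-- Overwriting an inessential entry q by x_p, or an inessential pair {p, r} by x_q, moves the tuple
to the diagonal (p, q), where `f` is known. Any other block would make `G` independent of a variable
it depends on. -/
theorem agree_pr (h : Twin f G G' p q r)
    (hbl : (∃ k, k ≠ p ∧ k ≠ r ∧ InessentialOn f p r {k}) ∨ InessentialOn f p r {p, r}) :
    AgreeOn f G p r ∨ AgreeOn f G' p r := by
  obtain ⟨hpq, hpr, hqr, hG, hGe, hG', hGe', hint, hf⟩ := id h
  have hf' := h.agree'
  rcases hbl with ⟨k, hkp, hkr, hk⟩ | hk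
  · by_cases hkq : k = q
    · left
      subst hkq
      intro x hx
      rw [hk x (Function.update x k (x p)) hx (by grind) (by grind), hf _ (by grind)]
      exact hG _ _ (by grind)
    · refine absurd hk (not_inessentialOn_of_lift (fun x => replaceTwo x q r (x p) (x p))
        (hGe k hkq hkr) (by grind [replaceTwo]) (fun x => ?_) (by grind [replaceTwo]))
      rw [hf _ (by grind [replaceTwo])]
      exact hG _ _ (by grind [replaceTwo])
  · right
    intro x hx
    rw [hk x (replaceTwo x p r (x q) (x q)) hx (by grind [replaceTwo]) (by grind [replaceTwo]),
      hf' _ (by grind [replaceTwo])]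
    exact hG' _ _ (by grind [replaceTwo])

theorem agree_rj (h : Twin f G G' p q r) (hjp : j ≠ p) (hjq : j ≠ q) (hjr : j ≠ r)
    (hbl : (∃ k, k ≠ r ∧ k ≠ j ∧ InessentialOn f r j {k}) ∨ InessentialOn f r j {r, j}) :
    AgreeOn f G r j ∨ AgreeOn f G' r j := by
  obtain ⟨hpq, hpr, hqr, hG, hGe, hG', hGe', hint, hf⟩ := id h
  have hf' := h.agree'
  rcases hbl with ⟨k, hkr, hkj, hk⟩ | hk
  · by_cases hkq : k = q
    · left
      subst hkq
      intro x hx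
      rw [hk x (Function.update x k (x p)) hx (by grind) (by grind), hf _ (by grind)]
      exact hG _ _ (by grind)
    by_cases hkp : k = p
    · right
      subst hkp
      intro x hx
      rw [hk x (Function.update x k (x q)) hx (by grind) (by grind), hf' _ (by grind)]
      exact hG' _ _ (by grind)
    refine absurd hk (not_inessentialOn_of_lift (fun x => replaceTwo x q r (x p) (x j))
        (hGe k hkq hkr) (by grind [replaceTwo]) (fun x => ?_) (by grind [replaceTwo]))
    rw [hf _ (by grind [replaceTwo])]
    exact hG _ _ (by grind [replaceTwo])
  · refine absurd hk (not_inessentialOn_of_lift (fun x => replaceTwo x q r (x p) (x j))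
        (hGe j hjq hjr) (by grind [replaceTwo]) (fun x => ?_) (by grind [replaceTwo]))
    rw [hf _ (by grind [replaceTwo])]
    exact hG _ _ (by grind [replaceTwo])

/-- The tuple with p, r, j all equal to x_j and q equal to x_p lies on both diagonals. Comparing the
two values of `f` there shows that `G` ignores entry p. -/
theorem not_agree'_pr (h : Twin f G G' p q r) (hjp : j ≠ p) (hjq : j ≠ q) (hjr : j ≠ r)
    (hrj : AgreeOn f G r j) : ¬ AgreeOn f G' p r := by
  obtain ⟨hpq, hpr, hqr, hG, hGe, hG', hGe', hint, hf⟩ := id h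
  intro hpr'
  obtain ⟨x, y, hxy, hne⟩ := hGe p hpq hpr
  have key : ∀ x : ι → A, G x = G (Function.update x p (x j)) := by
    intro x
    let z := fun l => if l = p then x j else if l = r then x j else if l = q then x p else x l
    rw [← hint x z (by grind) (by grind), ← hpr' z (by grind), hrj z (by grind)]
    exact hG _ _ (by grind)
  apply hne
  rw [key x, key y]
  exact hG _ _ (by grind)

/-- `f` cannot agree with `G` for one index and with `G'` for another. -/
theorem not_mixed (h : Twin f G G' p q r) {j j' : ι} (hjp : j ≠ p) (hjq : j ≠ q) (hjr : j ≠ r)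
    (hjp' : j' ≠ p) (hjq' : j' ≠ q) (hjr' : j' ≠ r) (hjj : j ≠ j')
    (hrj : AgreeOn f G r j) (hrj' : AgreeOn f G' r j') (hqr' : AgreeOn f G' q r)
    (hbl : (∃ k, k ≠ p ∧ k ≠ j ∧ InessentialOn f p j {k}) ∨ InessentialOn f p j {p, j}) :
    False := by
  obtain ⟨hpq, hpr, hqr, hG, hGe, hG', hGe', hint, hf⟩ := id h
  -- `t x` lies on (p, j) and on (r, j'); agreement with `G'` on the latter, followed by
  -- interchanging p and q, gives `G x`.
  let t : (ι → A) → ι → A := fun x l =>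
    if l = q then x p else if l = p then x j else if l = r then x j' else x l
  have ht : ∀ x, f (t x) = G x := fun x => by
    rw [hrj' _ (by grind), hint x (t x) (by grind) (by grind)]
  rcases hbl with ⟨k, hkp, hkj, hk⟩ | hk
  · by_cases hkq : k = q
    · exact not_inessentialOn_of_lift t (hGe p hpq hpr) (by grind) ht (by grind) hk
    by_cases hkr : k = r
    · obtain ⟨x, y, hxy, hne⟩ := hGe p hpq hpr
      have key : ∀ x : ι → A, G x = G (Function.update x p (x j)) := by
        intro x
        rw [← ht, hk (t x) (Function.update (t x) r (x j)) (by grind) (by grind) (by grind),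
          hrj _ (by grind)]
        exact hG _ _ (by grind)
      apply hne
      rw [key x, key y]
      exact hG _ _ (by grind)
    -- In `t`, entry r varies with j'. Here r copies x_p instead, which puts the tuple on (q, r).
    by_cases hkj' : k = j'
    · refine not_inessentialOn_of_lift (fun x l =>
        if l = q then x p else if l = p then x j else if l = r then x p else x l)
        (hGe k hkq hkr) (by grind) (fun x => ?_) (by grind) hk
      rw [hqr' _ (by grind), hint x _ (by grind) (by grind)]
    · exact not_inessentialOn_of_lift t (hGe k hkq hkr) (by grind) ht (by grind) hk
  · exact not_inessentialOn_of_lift t (hGe j hjq hjr) (by grind) ht (by grind) hk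

theorem agree_qj (h : Twin f G G' p q r) (hjp : j ≠ p) (hjq : j ≠ q) (hjr : j ≠ r)
    (hrj : AgreeOn f G r j) (hprG : AgreeOn f G p r)
    (hbl : (∃ k, k ≠ q ∧ k ≠ j ∧ InessentialOn f q j {k}) ∨ InessentialOn f q j {q, j}) :
    AgreeOn f G q j := by
  obtain ⟨hpq, hpr, hqr, hG, hGe, hG', hGe', hint, hf⟩ := id h
  have ht : ∀ x, f (replaceTwo x q r (x j) (x p)) = G x := fun x => by
    rw [hprG _ (by grind [replaceTwo])]
    exact hG _ _ (by grind [replaceTwo])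
  rcases hbl with ⟨k, hkq, hkj, hk⟩ | hk
  · by_cases hkr : k = r
    · subst hkr
      intro x hx
      rw [hk x (Function.update x k (x p)) hx (by grind) (by grind), hprG _ (by grind)]
      exact hG _ _ (by grind)
    by_cases hkp : k = p
    · subst hkp
      refine absurd hk (not_inessentialOn_of_lift (fun x => replaceTwo x q r (x j) (x j))
        (hGe k hkq hkr) (by grind [replaceTwo]) (fun x => ?_) (by grind [replaceTwo]))
      rw [hrj _ (by grind [replaceTwo])]
      exact hG _ _ (by grind [replaceTwo])
    exact absurd hk (not_inessentialOn_of_lift (fun x => replaceTwo x q r (x j) (x p))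
        (hGe k hkq hkr) (by grind [replaceTwo]) ht (by grind [replaceTwo]))
  · exact absurd hk (not_inessentialOn_of_lift (fun x => replaceTwo x q r (x j) (x p))
        (hGe j hjq hjr) (by grind [replaceTwo]) ht (by grind [replaceTwo]))

theorem agree_qr (h : Twin f G G' p q r) (hjp : j ≠ p) (hjq : j ≠ q) (hjr : j ≠ r)
    (hrj : AgreeOn f G r j) (hprG : AgreeOn f G p r)
    (hbl : (∃ k, k ≠ q ∧ k ≠ r ∧ InessentialOn f q r {k}) ∨ InessentialOn f q r {q, r}) :
    AgreeOn f G q r := by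
  obtain ⟨hpq, hpr, hqr, hG, hGe, hG', hGe', hint, hf⟩ := id h
  rcases hbl with ⟨k, hkq, hkr, hk⟩ | hk
  · by_cases hkp : k = p
    · subst hkp
      refine absurd hk (not_inessentialOn_of_lift (fun x => replaceTwo x q r (x j) (x j))
        (hGe k hkq hkr) (by grind [replaceTwo]) (fun x => ?_) (by grind [replaceTwo]))
      rw [hrj _ (by grind [replaceTwo])]
      exact hG _ _ (by grind [replaceTwo])
    · refine absurd hk (not_inessentialOn_of_lift (fun x => replaceTwo x q r (x p) (x p))
        (hGe k hkq hkr) (by grind [replaceTwo]) (fun x => ?_) (by grind [replaceTwo]))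
      rw [hprG _ (by grind [replaceTwo])]
      exact hG _ _ (by grind [replaceTwo])
  · intro x hx
    rw [hk x (replaceTwo x q r (x p) (x p)) hx (by grind [replaceTwo]) (by grind [replaceTwo]),
      hprG _ (by grind [replaceTwo])]
    exact hG _ _ (by grind [replaceTwo])

/-- Fill the block K with x_q to reach the diagonal (q, c), where `f` is `G`. As `G` ignores r,
entry r may be set to x_c; undoing the filling then leads to the diagonal (r, c), where `f` is again
`G`. -/
theorem agree_disjoint {K : Set ι} {c : ι} (h : Twin f G G' p q r)
    (hq : ∀ j, j ≠ q → AgreeOn f G q j) (hr : ∀ j, j ≠ r → AgreeOn f G r j)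
    (hir : i ≠ r) (hjr : j ≠ r) (hqK : q ∉ K) (hrK : r ∉ K) (hK : (i ∈ K ↔ j ∈ K)) (hc : c ∈ K)
    (hk : InessentialOn f i j K) :
    AgreeOn f G i j := by
  classical
  obtain ⟨hpq, hpr, hqr, hG, hGe, hG', hGe', hint, hf⟩ := id h
  intro x hx
  have hcq : c ≠ q := by grind
  have hcr : c ≠ r := by grind
  have e1 : f x = f (fun l => if l ∈ K then x q else x l) :=
    hk _ _ hx (by grind) (by grind)
  have e2 : f (Function.update x r (x c)) =
      f (fun l => if l ∈ K then x q else if l = r then x c else x l) :=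
    hk _ _ (by grind) (by grind) (by grind)
  rw [e1, hq c hcq _ (by grind), hG _ (fun l => if l ∈ K then x q else if l = r then x c else x l)
    (by grind), ← hq c hcq _ (by grind), ← e2, hr c hcr _ (by grind)]
  exact hG _ _ (by grind)

/-- One diagonal (r, j₀) decides between `G` and `G'`: the opposite choice at (p, r) or at another
(r, j) is excluded. Diagonals through r and then q follow, and `agree_disjoint` handles the rest,
unless the block is q or r and can be overwritten directly. -/
theorem agree_all (h : Twin f G G' p q r) {j₀ : ι} (hjp : j₀ ≠ p) (hjq : j₀ ≠ q) (hjr : j₀ ≠ r)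
    (hrj : AgreeOn f G r j₀)
    (hbl : ∀ i j, i ≠ j →
      (∃ k, k ≠ i ∧ k ≠ j ∧ InessentialOn f i j {k}) ∨ InessentialOn f i j {i, j})
    (hij : i ≠ j) : AgreeOn f G i j := by
  obtain ⟨hpq, hpr, hqr, hG, hGe, hG', hGe', hint, hf⟩ := id h
  have hprG : AgreeOn f G p r :=
    (h.agree_pr (hbl p r hpr)).resolve_right (h.not_agree'_pr hjp hjq hjr hrj)
  have hr : ∀ j, j ≠ p → j ≠ q → j ≠ r → AgreeOn f G r j := by
    intro j h1 h2 h3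
    by_cases hj : j₀ = j
    · exact hj ▸ hrj
    refine (h.agree_rj h1 h2 h3 (hbl r j h3.symm)).resolve_right fun hbad => ?_
    have hqr' := (h.symm.agree_pr (hbl q r hqr)).resolve_right
      (h.symm.not_agree'_pr h2 h1 h3 hbad)
    exact h.not_mixed hjp hjq hjr h1 h2 h3 hj hrj hbad hqr' (hbl p j₀ hjp.symm)
  have hqrG := h.agree_qr hjp hjq hjr hrj hprG (hbl q r hqr)
  have hr' : ∀ j, j ≠ r → AgreeOn f G r j := by
    intro j hj
    by_cases h1 : j = p
    · exact h1 ▸ hprG.symm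
    by_cases h2 : j = q
    · exact h2 ▸ hqrG.symm
    exact hr j h1 h2 hj
  have hq' : ∀ j, j ≠ q → AgreeOn f G q j := by
    intro j hj
    by_cases h1 : j = p
    · exact h1 ▸ hf.symm
    by_cases h2 : j = r
    · exact h2 ▸ hqrG
    exact h.agree_qj h1 hj h2 (hr j h1 hj h2) hprG (hbl q j hj.symm)
  by_cases hiq : i = q
  · subst hiq; exact hq' j hij.symm
  by_cases hir : i = r
  · subst hir; exact hr' j hij.symm
  by_cases hjq' : j = q
  · subst hjq'; exact (hq' i hij).symm
  by_cases hjr' : j = r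
  · subst hjr'; exact (hr' i hij).symm
  rcases hbl i j hij with ⟨k, hki, hkj, hk⟩ | hk
  · by_cases hkq : k = q
    · subst hkq
      intro x hx
      rw [hk x (Function.update x k (x p)) hx (by grind) (by grind), hf _ (by grind)]
      exact hG _ _ (by grind)
    by_cases hkr : k = r
    · subst hkr
      intro x hx
      rw [hk x (Function.update x k (x p)) hx (by grind) (by grind), hprG _ (by grind)]
      exact hG _ _ (by grind)
    exact h.agree_disjoint (c := k) hq' hr' hir hjr' (by grind) (by grind) (by grind)
      (by grind) hk
  · exact h.agree_disjoint (c := i) hq' hr' hir hjr' (by grind) (by grind) (by grind)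
      (by grind) hk

end Twin

end Agreement

/-! ### A single inessential entry versus an inessential pair. -/

section Dichotomy

variable {ι A B : Type*} [DecidableEq ι] {f : (ι → A) → B} {p q r i j k : ι}

/-- The twin associated with `f` that, on the tuples with equal entries `p` and `q`, depends on
everything but the entry `r`. -/
theorem twin_of_inessentialOn (hpq : p ≠ q) (hpr : p ≠ r) (hqr : q ≠ r)
    (hr : InessentialOn f p q {r}) (hpair : ¬ InessentialOn f p q {p, q})
    (hk : ∀ k, k ≠ p → k ≠ q → k ≠ r → ¬ InessentialOn f p q {k}) :
    Twin f (fun x => f (replaceTwo x q r (x p) (x p))) (fun x => f (replaceTwo x p r (x q) (x q)))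
      p q r where
  hpq := hpq
  hpr := hpr
  hqr := hqr
  eq_of_eq := fun x y hxy => congrArg f (by funext l; grind [replaceTwo])
  eq_of_eq' := fun x y hxy => congrArg f (by funext l; grind [replaceTwo])
  depends := by
    intro k hkq hkr
    by_contra! hcon
    by_cases hkp : k = p
    · subst hkp
      refine hpair fun x y hx hy hxy => ?_
      have h := hcon x (Function.update x k (y k)) (by grind)
      rw [hr x (replaceTwo x q r (x k) (x k)) hx (by grind [replaceTwo]) (by grind [replaceTwo]), h]
      exact hr _ _ (by grind [replaceTwo]) hy (by grind [replaceTwo])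
    · refine hk k hkp hkq hkr fun x y hx hy hxy => ?_
      rw [hr x (replaceTwo x q r (x p) (x p)) hx (by grind [replaceTwo]) (by grind [replaceTwo]),
        hcon x y (by grind)]
      exact hr _ _ (by grind [replaceTwo]) hy (by grind [replaceTwo])
  depends' := by
    intro k hkp hkr
    by_contra! hcon
    by_cases hkq : k = q
    · subst hkq
      refine hpair fun x y hx hy hxy => ?_
      have h := hcon x (Function.update x k (y k)) (by grind)
      rw [hr x (replaceTwo x p r (x k) (x k)) hx (by grind [replaceTwo]) (by grind [replaceTwo]), h]
      exact hr _ _ (by grind [replaceTwo]) hy (by grind [replaceTwo])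
    · refine hk k hkp hkq hkr fun x y hx hy hxy => ?_
      rw [hr x (replaceTwo x p r (x q) (x q)) hx (by grind [replaceTwo]) (by grind [replaceTwo]),
        hcon x y (by grind)]
      exact hr _ _ (by grind [replaceTwo]) hy (by grind [replaceTwo])
  interchange := fun x z h1 h2 => congrArg f (by funext l; grind [replaceTwo])
  agree := fun x hx => hr _ _ hx (by grind [replaceTwo]) (by grind [replaceTwo])

/-- If `f` has an inessential block on each diagonal, and on one of them exactly one, which is
a single entry, then the restriction of `f` to the union of the diagonals extends to a function
that does not depend on that entry. -/
theorem exists_agreeOn_of_inessentialOn_single (hpq : p ≠ q) (hpr : p ≠ r) (hqr : q ≠ r)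
    (hj : ∃ j, j ≠ p ∧ j ≠ q ∧ j ≠ r)
    (hbl : ∀ i j, i ≠ j →
      (∃ k, k ≠ i ∧ k ≠ j ∧ InessentialOn f i j {k}) ∨ InessentialOn f i j {i, j})
    (hr : InessentialOn f p q {r}) (hpair : ¬ InessentialOn f p q {p, q})
    (hk : ∀ k, k ≠ p → k ≠ q → k ≠ r → ¬ InessentialOn f p q {k}) :
    ∃ g : (ι → A) → B, (∀ i j, i ≠ j → AgreeOn f g i j) ∧
      ∀ x y : ι → A, (∀ l, l ≠ r → x l = y l) → g x = g y := by
  have h := twin_of_inessentialOn hpq hpr hqr hr hpair hk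
  obtain ⟨j, hjp, hjq, hjr⟩ := hj
  rcases h.agree_rj hjp hjq hjr (hbl r j hjr.symm) with hrj | hrj
  · exact ⟨_, fun i j hij => h.agree_all hjp hjq hjr hrj hbl hij,
      fun x y hxy => h.eq_of_eq x y fun l _ hl => hxy l hl⟩
  · exact ⟨_, fun i j hij => h.symm.agree_all hjq hjp hjr hrj hbl hij,
      fun x y hxy => h.symm.eq_of_eq x y fun l _ hl => hxy l hl⟩

/-- On the tuples with equal entries `p` and `q`, `f` depends exactly on the other entries. -/
def OnlyPairInessential (f : (ι → A) → B) (p q : ι) : Prop :=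
  InessentialOn f p q {p, q} ∧ ∀ k, k ≠ p → k ≠ q → ¬ InessentialOn f p q {k}

omit [DecidableEq ι] in
theorem OnlyPairInessential.symm (h : OnlyPairInessential f p q) : OnlyPairInessential f q p :=
  ⟨Set.pair_comm p q ▸ h.1.symm, fun k hkq hkp hk => h.2 k hkp hkq hk.symm⟩

/-- On (p, q) both entries can be set to x_r, reaching (p, r). So another inessential entry on (p,
r), or {q} together with {p, r}, would yield an inessential entry on (p, q); {q} as the only block
is ruled out by `hno`. -/
theorem OnlyPairInessential.step (h : OnlyPairInessential f p q) (hpq : p ≠ q) (hpr : p ≠ r)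
    (hqr : q ≠ r)
    (hbl : (∃ k, k ≠ p ∧ k ≠ r ∧ InessentialOn f p r {k}) ∨ InessentialOn f p r {p, r})
    (hno : InessentialOn f p r {q} → ¬ InessentialOn f p r {p, r} →
      ∃ k, k ≠ p ∧ k ≠ r ∧ k ≠ q ∧ InessentialOn f p r {k}) :
    OnlyPairInessential f p r := by
  obtain ⟨h1, h2⟩ := h
  have hne : ∀ k, k ≠ p → k ≠ r → k ≠ q → ¬ InessentialOn f p r {k} := by
    intro k hkp hkr hkq hk
    refine h2 k hkp hkq fun x y hx hy hxy => ?_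
    rw [h1 x (replaceTwo x p q (x r) (x r)) hx (by grind [replaceTwo]) (by grind [replaceTwo]),
      hk _ (replaceTwo y p q (y r) (y r)) (by grind [replaceTwo]) (by grind [replaceTwo])
        (by grind [replaceTwo])]
    exact h1 _ _ (by grind [replaceTwo]) hy (by grind [replaceTwo])
  have hboth : InessentialOn f p r {q} → ¬ InessentialOn f p r {p, r} := by
    intro hq hp
    refine h2 r hpr.symm hqr.symm fun x y hx hy hxy => ?_
    rw [h1 x (replaceTwo x p q (x r) (x r)) hx (by grind [replaceTwo]) (by grind [replaceTwo]),
      hq _ (replaceTwo x p q (x r) (y r)) (by grind [replaceTwo]) (by grind [replaceTwo])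
        (by grind [replaceTwo]),
      hp _ (replaceTwo y p q (y r) (y r)) (by grind [replaceTwo]) (by grind [replaceTwo])
        (by grind [replaceTwo])]
    exact h1 _ _ (by grind [replaceTwo]) hy (by grind [replaceTwo])
  have hnq : ¬ InessentialOn f p r {q} := fun hq => by
    obtain ⟨k, hkp, hkr, hkq, hk⟩ := hno hq (hboth hq)
    exact hne k hkp hkr hkq hk
  have hn : ∀ k, k ≠ p → k ≠ r → ¬ InessentialOn f p r {k} := by
    intro k hkp hkr
    by_cases hkq : k = q
    · exact hkq ▸ hnq
    · exact hne k hkp hkr hkq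
  refine ⟨hbl.resolve_left ?_, hn⟩
  rintro ⟨k, hkp, hkr, hk⟩
  exact hn k hkp hkr hk

theorem OnlyPairInessential.all (h : OnlyPairInessential f p q) (hpq : p ≠ q)
    (hbl : ∀ i j, i ≠ j →
      (∃ k, k ≠ i ∧ k ≠ j ∧ InessentialOn f i j {k}) ∨ InessentialOn f i j {i, j})
    (hno : ∀ p q r, p ≠ q → p ≠ r → q ≠ r → InessentialOn f p q {r} →
      ¬ InessentialOn f p q {p, q} → ∃ k, k ≠ p ∧ k ≠ q ∧ k ≠ r ∧ InessentialOn f p q {k})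
    (hij : i ≠ j) : OnlyPairInessential f i j := by
  have step : ∀ {p q r : ι}, OnlyPairInessential f p q → p ≠ q → p ≠ r →
      OnlyPairInessential f p r := by
    intro p q r h hpq hpr
    by_cases hqr : q = r
    · exact hqr ▸ h
    · exact h.step hpq hpr hqr (hbl p r hpr) (hno p r q hpr hpq (Ne.symm hqr))
  by_cases hip : i = p
  · subst hip; exact step h hpq hij
  · exact step (step h hpq (Ne.symm hip)).symm hip hij

/-- A function that does not depend on equal entries is invariant, on the tuples with a repetition,
under transpositions of the entries. -/
theorem apply_comp_swap (h : ∀ i j, i ≠ j → InessentialOn f i j {i, j}) {x : ι → A}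
    {u v : ι} (huv : u ≠ v) (hx : x u = x v) (i j : ι) : f (x ∘ Equiv.swap i j) = f x := by
  have common : ∀ i j l : ι, i ≠ j → l ≠ i → x i = x l → f (x ∘ Equiv.swap i j) = f x := by
    intro i j l hij hli hil
    by_cases hlj : l = j
    · congr 1
      funext m
      grind
    · rw [h i l (by grind) x (replaceTwo x i l (x j) (x j)) hil (by grind [replaceTwo])
        (by grind [replaceTwo])]
      exact (h j l (by grind) _ _ (by grind [replaceTwo])
        (by grind) (by grind [replaceTwo])).symm
  by_cases hij : i = j
  · subst hij; simp
  by_cases h1 : u = i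
  · exact common i j v hij (by grind) (by grind)
  by_cases h2 : v = i
  · exact common i j u hij (by grind) (by grind)
  by_cases h3 : u = j
  · rw [Equiv.swap_comm]
    exact common j i v (by grind) (by grind) (by grind)
  by_cases h4 : v = j
  · rw [Equiv.swap_comm]
    exact common j i u (by grind) (by grind) (by grind)
  -- The repeated pair u, v serves as scratch space: u stores x_i while i receives x_j, and then j
  -- receives x_i.
  let y₁ := replaceTwo x u v (x i) (x i)
  let y₂ := replaceTwo y₁ i u (x j) (x j)
  let y₃ := replaceTwo y₂ j u (x i) (x i)
  calc f (x ∘ Equiv.swap i j) = f y₃ := by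
        refine h u v huv _ _ ?_ ?_ ?_
        · grind
        · grind [replaceTwo]
        · intro l hl; grind [replaceTwo]
    _ = f y₂ := (h j u (by grind) _ _ (by grind [replaceTwo]) (by grind [replaceTwo])
        (by grind [replaceTwo])).symm
    _ = f y₁ := (h i u (by grind) _ _ (by grind [replaceTwo]) (by grind [replaceTwo])
        (by grind [replaceTwo])).symm
    _ = f x := (h u v huv _ _ hx (by grind [replaceTwo]) (by grind [replaceTwo])).symm

end Dichotomy

/-! ### Multisets of entries and odd supports. -/

section Oddsupp

variable {A B : Type*} {n : ℕ}

/-- The multiset of the entries of a tuple. -/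
def entries (a : Fin n → A) : Multiset A := Finset.univ.val.map a

theorem card_entries (a : Fin n → A) : (entries a).card = n := by simp [entries]

theorem count_entries [DecidableEq A] (a : Fin n → A) (x : A) :
    (entries a).count x = {j : Fin n | a j = x}.ncard := by
  rw [entries, Multiset.count_map, Set.ncard_eq_toFinset_card']
  simp only [Set.toFinset_ofPred, Finset.card_def, Finset.filter_val]
  congr 2
  funext j
  exact propext eq_comm

theorem mem_oddsupp_iff [DecidableEq A] (a : Fin n → A) (x : A) :
    x ∈ oddsupp a ↔ Odd ((entries a).count x) := by
  rw [count_entries]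
  constructor
  · rintro ⟨i, rfl, h⟩
    exact h
  · intro h
    obtain ⟨i, hi⟩ : {j : Fin n | a j = x}.Nonempty :=
      Set.nonempty_of_ncard_ne_zero (by rintro h0; simp [h0] at h)
    have hi : a i = x := hi
    exact ⟨i, hi, by rw [hi]; exact h⟩

theorem oddsupp_eq_of_entries_eq {a b : Fin n → A} (h : entries a = entries b) :
    oddsupp a = oddsupp b := by
  classical
  ext x
  rw [mem_oddsupp_iff, mem_oddsupp_iff, h]

theorem exists_perm_of_entries_eq {a b : Fin n → A} (h : entries a = entries b) :
    ∃ σ : Equiv.Perm (Fin n), a = b ∘ σ := by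
  classical
  have e : ∀ x, Nonempty ({i // a i = x} ≃ {i // b i = x}) := fun x => by
    have hx := congrArg (Multiset.count x) h
    rw [count_entries, count_entries] at hx
    exact Finite.card_eq.1 hx
  have e := fun x => (e x).some
  refine ⟨(Equiv.sigmaFiberEquiv a).symm.trans
    ((Equiv.sigmaCongrRight fun x => e x).trans (Equiv.sigmaFiberEquiv b)), ?_⟩
  funext i
  exact ((e (a i)) ⟨i, rfl⟩).2.symm

theorem entries_comp_perm (a : Fin n → A) (σ : Equiv.Perm (Fin n)) :
    entries (a ∘ σ) = entries a := by
  change Multiset.map (a ∘ σ) Finset.univ.val = Multiset.map a Finset.univ.val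
  rw [← Multiset.map_map, Multiset.map_univ_val_equiv]

theorem exists_entries_eq (M : Multiset A) (hM : M.card = n) : ∃ a : Fin n → A, entries a = M := by
  subst hM
  induction M using Quotient.inductionOn with
  | _ l =>
    exact ⟨l.get, (Fin.univ_val_map _).trans (congrArg _ (List.ofFn_get l))⟩

theorem mem_tuplesWithRepetition_iff {a : Fin n → A} :
    a ∈ tuplesWithRepetition A n ↔ ¬ (entries a).Nodup := by
  rw [entries, Multiset.nodup_map_iff_inj_on Finset.univ.nodup]
  simp only [Finset.mem_val, Finset.mem_univ, forall_const, tuplesWithRepetition]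
  constructor
  · rintro ⟨i, j, hij, h⟩ hinj
    exact hij (hinj i j h)
  · intro h
    push Not at h
    obtain ⟨i, j, h, hij⟩ := h
    exact ⟨i, j, hij, h⟩

theorem entries_cons {m : ℕ} (t : A) (d : Fin m → A) :
    entries (Fin.cons t d : Fin (m + 1) → A) = t ::ₘ entries d := by
  simp [entries, Fin.univ_val_map]

/-- A multiset consists of the elements of odd multiplicity and of a multiset taken twice. -/
theorem exists_eq_add_double [DecidableEq A] (M : Multiset A) :
    ∃ (S : Finset A) (T : Multiset A), M = S.val + (T + T) ∧ ∀ x, x ∈ S ↔ Odd (M.count x) := by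
  refine ⟨M.toFinset.filter fun x => Odd (M.count x),
    ∑ x ∈ M.toFinset, (M.count x / 2) • {x}, ?_, ?_⟩
  · ext x
    simp only [Multiset.count_add, Multiset.count_sum', Multiset.count_nsmul,
      Multiset.count_singleton, Multiset.count_eq_of_nodup (Finset.nodup _)]
    by_cases hx : x ∈ M
    · simp [hx]
      split_ifs with h
      · obtain ⟨k, hk⟩ := h; omega
      · obtain ⟨k, hk⟩ := Nat.not_odd_iff_even.1 h; omega
    · simp [hx]
  · intro x
    simp only [Finset.mem_filter, Multiset.mem_toFinset, and_iff_right_iff_imp]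
    intro h
    rw [← Multiset.count_pos]
    exact h.pos

theorem exists_entries_eq_add_double {a : Fin n → A} :
    ∃ (S : Finset A) (T : Multiset A), entries a = S.val + (T + T) ∧ oddsupp a = S := by
  classical
  obtain ⟨S, T, h1, h2⟩ := exists_eq_add_double (entries a)
  exact ⟨S, T, h1, by ext x; rw [mem_oddsupp_iff, Finset.mem_coe, h2]⟩

theorem card_pos_of_mem_tuplesWithRepetition {a : Fin n → A} (ha : a ∈ tuplesWithRepetition A n)
    {S : Finset A} {T : Multiset A} (h : entries a = S.val + (T + T)) : 0 < T.card := by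
  rw [Multiset.card_pos]
  rintro rfl
  rw [mem_tuplesWithRepetition_iff, h] at ha
  exact ha (by simpa using S.nodup)

theorem oddsupp_mem_paritySubsets {a : Fin n → A} (ha : a ∈ tuplesWithRepetition A n) :
    oddsupp a ∈ paritySubsets A n := by
  obtain ⟨S, T, h1, h2⟩ := exists_entries_eq_add_double (a := a)
  have hT := card_pos_of_mem_tuplesWithRepetition ha h1
  have hc := congrArg Multiset.card h1
  rw [card_entries, Multiset.card_add, Multiset.card_add, Finset.card_val] at hc
  rw [h2, paritySubsets, Set.mem_ofPred_eq, Set.ncard_coe_finset]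
  refine ⟨?_, by omega⟩
  rw [hc, ← two_mul, Nat.odd_add]
  simp

/-- Every admissible set is the odd support of a tuple with prescribed repetition. -/
theorem exists_oddsupp_eq [Finite A] [Nonempty A] {S : Set A} (hS : S ∈ paritySubsets A n)
    {i j : Fin n} (hij : i ≠ j) : ∃ a : Fin n → A, a i = a j ∧ oddsupp a = S := by
  classical
  obtain ⟨S, rfl⟩ : ∃ S' : Finset A, (S' : Set A) = S := ⟨S.toFinite.toFinset, by simp⟩
  obtain ⟨hpar, hcard⟩ := hS
  rw [Set.ncard_coe_finset] at hpar hcard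
  obtain ⟨k, hk⟩ : ∃ k, n = S.card + 2 * (k + 1) := by
    have : Even (n - S.card) := by
      rw [Nat.even_sub (by omega)]
      rw [← Nat.not_odd_iff_even, ← Nat.not_odd_iff_even, hpar]
    obtain ⟨c, hc⟩ := this
    -- The bound |S| + 2 ≤ n gives c ≥ 1, so the subtraction does not truncate.
    exact ⟨c - 1, by omega⟩
  let z : A := Classical.arbitrary A
  obtain ⟨a, ha⟩ := exists_entries_eq (n := n) (S.val + Multiset.replicate (2 * (k + 1)) z)
    (by simp [hk])
  have hrep : a ∈ tuplesWithRepetition A n := by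
    rw [mem_tuplesWithRepetition_iff, ha, Multiset.nodup_iff_count_le_one]
    intro h
    have := h z
    rw [Multiset.count_add, Multiset.count_replicate_self] at this
    omega
  obtain ⟨u, v, huv, hauv⟩ := hrep
  -- A permutation taking i to u and j to v, which moves the repetition to the prescribed places.
  let σ : Equiv.Perm (Fin n) := (Equiv.swap i u).trans (Equiv.swap (Equiv.swap i u j) v)
  refine ⟨a ∘ σ, ?_, ?_⟩
  · have h1 : σ i = u := by
      simp only [σ, Equiv.trans_apply, Equiv.swap_apply_left]
      grind
    have h2 : σ j = v := by simp [σ]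
    rw [Function.comp_apply, Function.comp_apply, h1, h2, hauv]
  · rw [oddsupp_eq_of_entries_eq (entries_comp_perm a σ)]
    ext x
    rw [mem_oddsupp_iff, ha, Multiset.count_add, Multiset.count_replicate,
      Multiset.count_eq_of_nodup S.nodup]
    by_cases hx : x ∈ S.val <;> by_cases hz : z = x <;>
      simp [hx, hz, ← Finset.mem_val]

variable {f : (Fin n → A) → B}

theorem apply_eq_of_entries_eq (h : ∀ i j, i ≠ j → InessentialOn f i j {i, j}) {a b : Fin n → A}
    (hb : b ∈ tuplesWithRepetition A n) (hab : entries a = entries b) : f a = f b := by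
  obtain ⟨σ, rfl⟩ := exists_perm_of_entries_eq hab
  clear hab
  induction σ using Equiv.Perm.swap_induction_on' with
  | one => rfl
  | mul_swap τ x y hxy ih =>
    obtain ⟨u, v, huv, hbuv⟩ := hb
    rw [← ih, Equiv.Perm.coe_mul, ← Function.comp_assoc]
    exact apply_comp_swap h (u := τ.symm u) (v := τ.symm v) (by simpa using huv)
      (by simpa using hbuv) x y

/-- Symmetry brings a doubled value t to the first two entries, where the inessential pair can be
overwritten by z, z. Induction on `T` turns all doubled values into copies of z, a normal form. -/
theorem apply_eq_of_double (h : ∀ i j, i ≠ j → InessentialOn f i j {i, j}) (z : A)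
    (T : Multiset A) : ∀ (R : Multiset A) (a b : Fin n → A), a ∈ tuplesWithRepetition A n →
      b ∈ tuplesWithRepetition A n → entries a = R + (T + T) →
      entries b = R + Multiset.replicate (2 * T.card) z → f a = f b := by
  induction T using Multiset.induction_on with
  | empty =>
    intro R a b _ hb h1 h2
    exact apply_eq_of_entries_eq h hb (by simpa [h2] using h1)
  | cons t T ih =>
    intro R a b ha hb h1 h2
    obtain ⟨m, rfl⟩ : ∃ m, n = m + 2 := by
      have := congrArg Multiset.card h1
      simp only [card_entries, Multiset.card_add, Multiset.card_cons] at this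
      exact ⟨n - 2, by omega⟩
    obtain ⟨d, hd⟩ := exists_entries_eq (n := m) (R + (T + T)) (by
      have := congrArg Multiset.card h1
      simp only [card_entries, Multiset.card_add, Multiset.card_cons] at this ⊢
      omega)
    let c : A → Fin (m + 2) → A := fun t => Fin.cons t (Fin.cons t d : Fin (m + 1) → A)
    have hc : ∀ t, c t ∈ tuplesWithRepetition A (m + 2) := fun t => ⟨0, 1, by simp, rfl⟩
    have hce : ∀ t, entries (c t) = t ::ₘ t ::ₘ (R + (T + T)) := fun t => by
      rw [entries_cons, entries_cons, hd]
    calc f a = f (c t) := apply_eq_of_entries_eq h (hc t) (by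
          rw [h1, hce]; simp [← Multiset.singleton_add]; abel)
      _ = f (c z) := h 0 1 (by simp) _ _ rfl rfl (by
          intro l hl
          induction l using Fin.cases with
          | zero => simp at hl
          | succ l =>
            induction l using Fin.cases with
            | zero => simp at hl
            | succ l => rfl)
      _ = f b := ih (z ::ₘ z ::ₘ R) _ _ (hc z) hb (by rw [hce]; simp) (by
          rw [h2, Multiset.card_cons, mul_add, Multiset.replicate_add]
          simp [Multiset.replicate_succ, ← Multiset.singleton_add]; abel)

theorem apply_eq_of_oddsupp_eq (h : ∀ i j, i ≠ j → InessentialOn f i j {i, j}) {a b : Fin n → A}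
    (ha : a ∈ tuplesWithRepetition A n) (hb : b ∈ tuplesWithRepetition A n)
    (hab : oddsupp a = oddsupp b) : f a = f b := by
  classical
  obtain ⟨S, T, h1, h2⟩ := exists_entries_eq_add_double (a := a)
  obtain ⟨S', T', h1', h2'⟩ := exists_entries_eq_add_double (a := b)
  obtain rfl : S = S' := Finset.coe_injective (by rw [← h2, ← h2', hab])
  have hc := congrArg Multiset.card h1
  have hc' := congrArg Multiset.card h1'
  simp only [card_entries, Multiset.card_add, Finset.card_val] at hc hc'
  have hT : T.card = T'.card := by omega
  have hpos := card_pos_of_mem_tuplesWithRepetition ha h1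
  obtain ⟨z, -⟩ := Multiset.card_pos_iff_exists_mem.1 hpos
  obtain ⟨c, hc⟩ := exists_entries_eq (n := n) (S.val + Multiset.replicate (2 * T.card) z) (by
    simp; omega)
  have hrep : c ∈ tuplesWithRepetition A n := by
    rw [mem_tuplesWithRepetition_iff, hc, Multiset.nodup_iff_count_le_one]
    intro h
    have := h z
    rw [Multiset.count_add, Multiset.count_replicate_self] at this
    omega
  rw [apply_eq_of_double h z T _ a c ha hrep h1 hc,
    apply_eq_of_double h z T' _ b c hb hrep h1' (hT ▸ hc)]

end Oddsupp

/-! ### Essential variables, identification minors and the gap. -/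

section Minors

variable {A B : Type*} {m n : ℕ} {f : (Fin n → A) → B} {i j k : Fin n}

/-- The simple minor of `f` obtained by substituting the variable `x_j` for `x_i`, seen as
a function of the same arity. -/
def identify (f : (Fin n → A) → B) (i j : Fin n) : (Fin n → A) → B :=
  fun x => f (Function.update x i (x j))

theorem apply_eq_of_eq_on_essential {x y : Fin n → A}
    (h : ∀ i, IsEssential f i → x i = y i) : f x = f y := by
  suffices H : ∀ (s : Finset (Fin n)) (x : Fin n → A), (∀ i, i ∉ s → x i = y i) →
      (∀ i ∈ s, ¬ IsEssential f i) → f x = f y by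
    classical
    refine H (Finset.univ.filter fun i => ¬ IsEssential f i) x (fun i hi => h i ?_) ?_
    · simpa using hi
    · simp
  intro s
  induction s using Finset.induction_on with
  | empty => exact fun x hx _ => congrArg f (funext fun i => hx i (by simp))
  | insert a s _ ih =>
    intro x hx hs
    rw [← ih (Function.update x a (y a)) (by grind) (by grind)]
    by_contra hne
    exact hs a (by simp) ⟨x, y a, hne⟩

theorem not_isEssential_iff :
    ¬ IsEssential f i ↔ ∀ x y : Fin n → A, (∀ l, l ≠ i → x l = y l) → f x = f y := by
  constructor
  · intro h x y hxy
    exact apply_eq_of_eq_on_essential fun l hl => hxy l (by rintro rfl; exact h hl)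
  · rintro h ⟨x, b, hne⟩
    exact hne (h _ _ (by grind))

theorem ess_le_of_isMinor {g : (Fin m → A) → B} (h : IsMinor g f) : ess g ≤ ess f := by
  obtain ⟨σ, hσ⟩ := h
  refine le_trans (Set.ncard_le_ncard (t := σ '' {i | IsEssential f i}) ?_)
    (Set.ncard_image_le (Set.toFinite _))
  rintro k ⟨a, b, hne⟩
  by_contra hk
  apply hne
  rw [hσ, hσ]
  refine apply_eq_of_eq_on_essential fun i hi => ?_
  rw [Function.update_of_ne]
  rintro rfl
  exact hk ⟨i, hi, rfl⟩

theorem ess_add_ncard (f : (Fin n → A) → B) : ess f + {i | ¬ IsEssential f i}.ncard = n := by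
  have h := Set.ncard_add_ncard_compl {i | IsEssential f i}
  rw [Nat.card_fin] at h
  exact h

theorem ess_eq_of_forall (hf : ∀ i, IsEssential f i) : ess f = n := by
  have h := ess_add_ncard f
  simpa [hf] using h

theorem isMinor_identify (f : (Fin n → A) → B) (i j : Fin n) : IsMinor (identify f i j) f :=
  ⟨Function.update id i j, fun a => congrArg f (by funext l; grind)⟩

theorem not_isEssential_identify_left (hij : i ≠ j) : ¬ IsEssential (identify f i j) i := by
  rw [not_isEssential_iff]
  exact fun x y hxy => congrArg f (by funext l; grind)

theorem not_isEssential_identify_right (hij : i ≠ j) :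
    ¬ IsEssential (identify f i j) j ↔ InessentialOn f i j {i, j} := by
  rw [not_isEssential_iff]
  constructor
  · intro h x y hx hy hxy
    have := h x (Function.update y i (x i)) (by grind)
    simp only [identify] at this
    convert this using 2 <;> · funext l; grind
  · exact fun h x y hxy => h _ _ (by grind) (by grind) (by grind)

theorem not_isEssential_identify_of_ne (hkj : k ≠ j) :
    ¬ IsEssential (identify f i j) k ↔ InessentialOn f i j {k} := by
  rw [not_isEssential_iff]
  constructor
  · intro h x y hx hy hxy
    have := h x y (by grind)
    simp only [identify] at this
    convert this using 2 <;> · funext l; grind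
  · exact fun h x y hxy => h _ _ (by grind) (by grind) (by grind)

theorem exists_ess_le_of_isStrictMinor {g : (Fin m → A) → B} (hn : 0 < n)
    (h : IsStrictMinor g f) : ∃ i j, i ≠ j ∧ ess g ≤ ess (identify f i j) := by
  obtain ⟨⟨σ, hσ⟩, hfg⟩ := h
  -- A left inverse of an injective substitution would exhibit `f` as a minor of `g`.
  have hinj : ¬ Function.Injective σ := fun hinj => by
    have : Nonempty (Fin n) := ⟨⟨0, hn⟩⟩
    refine hfg ⟨Function.invFun σ, fun b => ?_⟩
    rw [hσ]
    exact congrArg f (funext fun l => by rw [Function.leftInverse_invFun hinj])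
  simp only [Function.Injective, not_forall] at hinj
  obtain ⟨i, j, hij, hne⟩ := hinj
  refine ⟨i, j, hne, ess_le_of_isMinor ⟨σ, fun a => ?_⟩⟩
  rw [hσ]
  exact congrArg f (by funext l; grind)

theorem ess_identify_lt (hij : i ≠ j) : ess (identify f i j) < n := by
  have h := ess_add_ncard (identify f i j)
  have : 0 < {k | ¬ IsEssential (identify f i j) k}.ncard :=
    (Set.ncard_pos).2 ⟨i, not_isEssential_identify_left hij⟩
  omega

theorem isStrictMinor_identify (hf : ∀ i, IsEssential f i) (hij : i ≠ j) :
    IsStrictMinor (identify f i j) f := by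
  refine ⟨isMinor_identify f i j, fun h => ?_⟩
  have h1 := ess_le_of_isMinor h
  rw [ess_eq_of_forall hf] at h1
  exact absurd (ess_identify_lt (f := f) hij) (by omega)

theorem gap_eq_two_iff (hn : 3 < n) (hf : ∀ i, IsEssential f i) :
    gap f = 2 ↔ (∀ i j, i ≠ j → ess (identify f i j) ≤ n - 2) ∧
      ∃ i j, i ≠ j ∧ ess (identify f i j) = n - 2 := by
  set E := {e | ∃ (m : ℕ) (g : (Fin m → A) → B), IsStrictMinor g f ∧ ess g = e} with hE
  have hmem : ∀ i j, i ≠ j → ess (identify f i j) ∈ E := fun i j hij =>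
    ⟨n, _, isStrictMinor_identify hf hij, rfl⟩
  have hle : ∀ e ∈ E, ∃ i j, i ≠ j ∧ e ≤ ess (identify f i j) := by
    rintro e ⟨m, g, hg, rfl⟩
    exact exists_ess_le_of_isStrictMinor (by omega) hg
  have hbdd : BddAbove E := ⟨n, fun e he => by
    obtain ⟨i, j, hij, h⟩ := hle e he
    exact h.trans (ess_identify_lt hij).le⟩
  have hne : E.Nonempty :=
    ⟨_, hmem ⟨0, by omega⟩ ⟨1, by omega⟩ (by simp)⟩
  have hmax : ∃ i j, i ≠ j ∧ ess (identify f i j) = essLower f := by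
    obtain ⟨i, j, hij, h⟩ := hle _ (Nat.sSup_mem hne hbdd)
    exact ⟨i, j, hij, le_antisymm (le_csSup hbdd (hmem i j hij)) h⟩
  have hub : ∀ i j, i ≠ j → ess (identify f i j) ≤ essLower f := fun i j hij =>
    le_csSup hbdd (hmem i j hij)
  rw [gap, ess_eq_of_forall hf]
  constructor
  · intro h
    have h' : essLower f = n - 2 := by omega
    rw [h'] at hub hmax
    exact ⟨hub, hmax⟩
  · rintro ⟨h1, i, j, hij, h2⟩
    obtain ⟨i', j', hij', h3⟩ := hmax
    have h4 := h1 i' j' hij'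
    have h5 := hub i j hij
    omega

end Minors

/-! ### Supports and quasi-arity. -/

section QuasiArity

variable {A B : Type*} {n : ℕ} {f g : (Fin n → A) → B} {i j : Fin n}

theorem exists_isSupport_ess_eq_qa (f : (Fin n → A) → B) :
    ∃ g : (Fin n → A) → B, IsSupport g f ∧ ess g = qa f :=
  Nat.sInf_mem (s := {e | ∃ g : (Fin n → A) → B, IsSupport g f ∧ ess g = e})
    ⟨ess f, f, fun _ _ => rfl, rfl⟩

theorem qa_le_of_isSupport (h : IsSupport g f) : qa f ≤ ess g :=
  Nat.sInf_le ⟨g, h, rfl⟩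

theorem qa_le (f : (Fin n → A) → B) : qa f ≤ n :=
  (qa_le_of_isSupport (fun _ _ => rfl)).trans (by have := ess_add_ncard f; omega)

theorem identify_eq_of_isSupport (h : IsSupport g f) (hij : i ≠ j) :
    identify g i j = identify f i j := by
  funext x
  exact h ⟨i, j, hij, by grind⟩

theorem identify_eq_self (h : ¬ IsEssential g i) (j : Fin n) : identify g i j = g := by
  rw [not_isEssential_iff] at h
  funext x
  exact h _ _ (by grind)

theorem exists_not_isEssential_of_ess_lt (h : ess g < n) : ∃ i, ¬ IsEssential g i := by
  by_contra! hcon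
  exact h.ne (ess_eq_of_forall hcon)

end QuasiArity

/-! ### The two directions of the characterization. -/

section MainTheorem

variable {A B : Type*} {n : ℕ} {f : (Fin n → A) → B}

theorem exists_inessentialOn_of_ess_le {i j : Fin n} (hn : 3 < n) (hij : i ≠ j)
    (h : ess (identify f i j) ≤ n - 2) :
    (∃ k, k ≠ i ∧ k ≠ j ∧ InessentialOn f i j {k}) ∨ InessentialOn f i j {i, j} := by
  have hcard := ess_add_ncard (identify f i j)
  obtain ⟨k, hk, hki⟩ := Set.exists_ne_of_one_lt_ncard
    (s := {k | ¬ IsEssential (identify f i j) k}) (by omega) i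
  by_cases hkj : k = j
  · subst hkj
    exact Or.inr ((not_isEssential_identify_right hij).1 hk)
  · exact Or.inl ⟨k, hki, hkj, (not_isEssential_identify_of_ne hkj).1 hk⟩

theorem exists_ne_three (hn : 3 < n) (p q r : Fin n) : ∃ j, j ≠ p ∧ j ≠ q ∧ j ≠ r := by
  obtain ⟨j, hj⟩ : ∃ j, j ∉ ({p, q, r} : Finset (Fin n)) := by
    by_contra! hcon
    have h1 := Finset.card_le_three (a := p) (b := q) (c := r)
    rw [Finset.eq_univ_of_forall hcon, Finset.card_univ, Fintype.card_fin] at h1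
    omega
  exact ⟨j, by simpa using hj⟩

theorem forall_inessentialOn_pair (hn : 3 < n) (hqa : qa f = n)
    (h : ∀ i j, i ≠ j → ess (identify f i j) ≤ n - 2)
    (hex : ∃ i j, i ≠ j ∧ ess (identify f i j) = n - 2) {i j : Fin n} (hij : i ≠ j) :
    OnlyPairInessential f i j := by
  have hbl : ∀ i j, i ≠ j →
      (∃ k, k ≠ i ∧ k ≠ j ∧ InessentialOn f i j {k}) ∨ InessentialOn f i j {i, j} :=
    fun i j hij => exists_inessentialOn_of_ess_le hn hij (h i j hij)
  have hno : ∀ p q r, p ≠ q → p ≠ r → q ≠ r → InessentialOn f p q {r} →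
      ¬ InessentialOn f p q {p, q} →
      ∃ k, k ≠ p ∧ k ≠ q ∧ k ≠ r ∧ InessentialOn f p q {k} := by
    intro p q r hpq hpr hqr hr hpair
    by_contra! hcon
    obtain ⟨g, hg, hgr⟩ := exists_agreeOn_of_inessentialOn_single hpq hpr hqr
      (exists_ne_three hn p q r) hbl hr hpair hcon
    have hsup : IsSupport g f := by
      rintro x ⟨i, j, hij, hx⟩
      exact (hg i j hij x hx).symm
    have hcard := ess_add_ncard g
    have hpos : 0 < {k | ¬ IsEssential g k}.ncard :=
      (Set.ncard_pos).2 ⟨r, not_isEssential_iff.2 hgr⟩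
    have := qa_le_of_isSupport hsup
    omega
  obtain ⟨p, q, hpq, hess⟩ := hex
  have hcard := ess_add_ncard (identify f p q)
  obtain ⟨k, hkp, hk⟩ : ∃ k, k ≠ p ∧ {k | ¬ IsEssential (identify f p q) k} = {p, k} := by
    obtain ⟨a, b, hab, h2⟩ := Set.ncard_eq_two.1
      (show {k | ¬ IsEssential (identify f p q) k}.ncard = 2 by omega)
    have hp : p ∈ ({a, b} : Set (Fin n)) := h2 ▸ not_isEssential_identify_left hpq
    rcases hp with rfl | rfl
    · exact ⟨b, hab.symm, h2⟩
    · exact ⟨a, hab, h2.trans (Set.pair_comm _ _)⟩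
  have hiff : ∀ l, ¬ IsEssential (identify f p q) l ↔ l = p ∨ l = k := fun l => by
    rw [← Set.mem_insert_iff.trans (or_congr Iff.rfl Set.mem_singleton_iff), ← hk]
    rfl
  have hother : ∀ l, l ≠ p → l ≠ q → l ≠ k → ¬ InessentialOn f p q {l} := by
    intro l hlp hlq hlk hl
    rw [← not_isEssential_identify_of_ne hlq, hiff] at hl
    exact hl.elim hlp hlk
  by_cases hkq : k = q
  · subst hkq
    refine OnlyPairInessential.all ⟨?_, fun l hlp hlq => hother l hlp hlq hlq⟩ hpq hbl hno hij
    rw [← not_isEssential_identify_right hpq, hiff]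
    exact Or.inr rfl
  · obtain ⟨l, hlp, hlq, hlk, hl⟩ := hno p q k hpq hkp.symm (Ne.symm hkq)
      ((not_isEssential_identify_of_ne hkq).1 ((hiff k).2 (Or.inr rfl)))
      (fun hpair => by
        rw [← not_isEssential_identify_right hpq, hiff] at hpair
        exact hpair.elim hpq.symm (Ne.symm hkq))
    exact absurd hl (hother l hlp hlq hlk)

theorem restrictionDeterminedByOddsupp_of_onlyPairInessential (hn : 3 < n)
    (h : ∀ i j, i ≠ j → OnlyPairInessential f i j) : RestrictionDeterminedByOddsupp f := by
  classical
  have hpair : ∀ i j, i ≠ j → InessentialOn f i j {i, j} := fun i j hij => (h i j hij).1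
  let i₀ : Fin n := ⟨0, by omega⟩
  let i₁ : Fin n := ⟨1, by omega⟩
  have h01 : i₀ ≠ i₁ := by simp [i₀, i₁]
  -- Dependence on a third entry along this diagonal supplies the two values that make `fstar`
  -- nonconstant.
  have hdep := (h i₀ i₁ h01).2 ⟨2, by omega⟩ (by simp [i₀]) (by simp [i₁])
  simp only [InessentialOn, not_forall] at hdep
  obtain ⟨x, y, hx, hy, -, hne⟩ := hdep
  let fstar : Set A → B := fun S =>
    if hS : ∃ a ∈ tuplesWithRepetition A n, oddsupp a = S then f hS.choose else f x
  have hstar : ∀ a ∈ tuplesWithRepetition A n, f a = fstar (oddsupp a) := by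
    intro a ha
    have hS : ∃ b ∈ tuplesWithRepetition A n, oddsupp b = oddsupp a := ⟨a, ha, rfl⟩
    simp only [fstar, dif_pos hS]
    exact apply_eq_of_oddsupp_eq hpair ha hS.choose_spec.1 hS.choose_spec.2.symm
  have hx' : x ∈ tuplesWithRepetition A n := ⟨i₀, i₁, h01, hx⟩
  have hy' : y ∈ tuplesWithRepetition A n := ⟨i₀, i₁, h01, hy⟩
  refine ⟨fstar, ⟨_, oddsupp_mem_paritySubsets hx', _, oddsupp_mem_paritySubsets hy', ?_⟩, hstar⟩
  rwa [← hstar x hx', ← hstar y hy']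

/-- An equal pair contributes 0 or 2 to each multiplicity, so parities come from the other entries.
-/
theorem oddsupp_eq_of_pair {i j : Fin n} (hij : i ≠ j) {x y : Fin n → A} (hx : x i = x j)
    (hy : y i = y j) (hxy : ∀ l, l ≠ i → l ≠ j → x l = y l) : oddsupp x = oddsupp y := by
  classical
  have key : ∀ x : Fin n → A, x i = x j → ∀ v, v ∈ oddsupp x ↔
      Odd (((Finset.univ.erase i).erase j).filter fun l => x l = v).card := by
    intro x hx v
    rw [mem_oddsupp_iff, count_entries, Set.ncard_eq_toFinset_card', Set.toFinset_ofPred]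
    have hj : j ∈ Finset.univ.erase i := by simp [hij.symm]
    rw [Finset.card_filter, Finset.card_filter, ← Finset.add_sum_erase _ _ (Finset.mem_univ i),
      ← Finset.add_sum_erase _ _ hj, hx, ← add_assoc, ← two_mul, Nat.odd_add]
    have h2 : ¬ Odd 2 := by decide
    split_ifs <;> simp [h2]
  ext v
  rw [key x hx, key y hy]
  refine Eq.to_iff (congrArg Odd (congrArg Finset.card (Finset.filter_congr ?_)))
  intro l hl
  simp only [Finset.mem_erase, Finset.mem_univ, and_true] at hl
  rw [hxy l hl.2 hl.1]

theorem RestrictionDeterminedByOddsupp.inessentialOn (h : RestrictionDeterminedByOddsupp f)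
    {i j : Fin n} (hij : i ≠ j) : InessentialOn f i j {i, j} := by
  obtain ⟨fstar, -, hf⟩ := h
  intro x y hx hy hxy
  rw [hf x ⟨i, j, hij, hx⟩, hf y ⟨i, j, hij, hy⟩,
    oddsupp_eq_of_pair hij hx hy fun l hi hj => hxy l (by simp [hi, hj])]

theorem RestrictionDeterminedByOddsupp.not_inessentialOn [Finite A] [Nonempty A]
    (h : RestrictionDeterminedByOddsupp f) {i j k : Fin n} (hij : i ≠ j) (hki : k ≠ i)
    (hkj : k ≠ j) : ¬ InessentialOn f i j {k} := by
  intro hk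
  have hpair := h.inessentialOn hij
  obtain ⟨fstar, ⟨S, hS, T, hT, hne⟩, hf⟩ := h
  -- By symmetry, one inessential third entry makes all of them inessential, so `f` is constant on
  -- the diagonal. Every admissible set is an odd support there, contradicting nonconstancy of
  -- `fstar`.
  have hall : ∀ l, ¬ IsEssential (identify f i j) l := by
    intro l
    by_cases hli : l = i
    · subst hli; exact not_isEssential_identify_left hij
    by_cases hlj : l = j
    · subst hlj; exact (not_isEssential_identify_right hij).2 hpair
    rw [not_isEssential_identify_of_ne hlj]
    have hswap : ∀ x : Fin n → A, x i = x j → f x = f (x ∘ Equiv.swap k l) := fun x hx => by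
      rw [hf x ⟨i, j, hij, hx⟩, hf (x ∘ Equiv.swap k l) ⟨i, j, hij, by grind⟩,
        oddsupp_eq_of_entries_eq (entries_comp_perm x _)]
    intro x y hx hy hxy
    rw [hswap x hx, hswap y hy]
    exact hk _ _ (by grind) (by grind) (by grind)
  obtain ⟨a, ha, rfl⟩ := exists_oddsupp_eq hS hij
  obtain ⟨b, hb, rfl⟩ := exists_oddsupp_eq hT hij
  apply hne
  rw [← hf a ⟨i, j, hij, ha⟩, ← hf b ⟨i, j, hij, hb⟩]
  have := apply_eq_of_eq_on_essential (f := identify f i j) (x := a) (y := b)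
    fun l hl => absurd hl (hall l)
  simpa [identify, ← ha, ← hb] using this

theorem RestrictionDeterminedByOddsupp.ess_identify [Finite A] [Nonempty A]
    (h : RestrictionDeterminedByOddsupp f) {i j : Fin n} (hij : i ≠ j) :
    ess (identify f i j) = n - 2 := by
  have hcard := ess_add_ncard (identify f i j)
  have : {k | ¬ IsEssential (identify f i j) k} = {i, j} := by
    ext k
    by_cases hki : k = i
    · subst hki
      simpa using not_isEssential_identify_left hij
    by_cases hkj : k = j
    · subst hkj
      simpa using (not_isEssential_identify_right hij).2 (h.inessentialOn hij)
    have h1 := (not_isEssential_identify_of_ne hkj).not.2 (h.not_inessentialOn hij hki hkj)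
    simpa [hki, hkj] using h1
  rw [this, Set.ncard_pair hij] at hcard
  omega

end MainTheorem

end ArityGap

theorem mainTheorem4 {A B : Type*} [Finite A] {n : ℕ} (hn : 3 < n) (f : (Fin n → A) → B)
    (hf : ∀ i : Fin n, ArityGap.IsEssential f i) :
    ArityGap.gap f = 2 ↔
      ArityGap.qa f = n - 2 ∨
        (ArityGap.qa f = n ∧ ArityGap.RestrictionDeterminedByOddsupp f) := by
  open ArityGap in
  rw [gap_eq_two_iff hn hf]
  constructor
  · rintro ⟨hle, hex⟩
    by_cases hqa : qa f = n
    · exact Or.inr ⟨hqa, restrictionDeterminedByOddsupp_of_onlyPairInessential hn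
        fun i j hij => forall_inessentialOn_pair hn hqa hle hex hij⟩
    · left
      obtain ⟨g, hg, hgess⟩ := exists_isSupport_ess_eq_qa f
      have hlt : ess g < n := by have := qa_le f; omega
      obtain ⟨i, hi⟩ := exists_not_isEssential_of_ess_lt hlt
      obtain ⟨j, hj, -⟩ := exists_ne_three hn i i i
      have h1 := hle i j hj.symm
      -- Substituting for the inessential x_i leaves `g` unchanged, so `g` itself obeys the bound n
      -- - 2.
      rw [← identify_eq_of_isSupport hg hj.symm, identify_eq_self hi] at h1
      obtain ⟨p, q, hpq, h2⟩ := hex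
      have h3 := ess_le_of_isMinor (isMinor_identify g p q)
      rw [identify_eq_of_isSupport hg hpq] at h3
      omega
  · rintro (hqa | ⟨-, hodd⟩)
    · obtain ⟨g, hg, hgess⟩ := exists_isSupport_ess_eq_qa f
      obtain ⟨i, hi⟩ := exists_not_isEssential_of_ess_lt (g := g) (by omega)
      obtain ⟨j, hj, -⟩ := exists_ne_three hn i i i
      refine ⟨fun p q hpq => ?_, i, j, hj.symm, ?_⟩
      · rw [← identify_eq_of_isSupport hg hpq, ← hqa, ← hgess]
        exact ess_le_of_isMinor (isMinor_identify g p q)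
      · rw [← identify_eq_of_isSupport hg hj.symm, identify_eq_self hi, hgess, hqa]
    · obtain ⟨a, -⟩ := hf ⟨0, by omega⟩
      have : Nonempty A := ⟨a ⟨0, by omega⟩⟩
      exact ⟨fun i j hij => (hodd.ess_identify hij).le, ⟨0, by omega⟩, ⟨1, by omega⟩, by simp,
        hodd.ess_identify (by simp)⟩
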